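/- Let $n\ge 1$, $\theta\in\mathbb{R}\setminus\pi\mathbb{Z}$. For $f\in L^1(\mathbb{R}^n)\cap L^2(\mathbb{R}^n)$ let $$\mathscr{F}_\theta f(\omega)=|\sin\theta|^{-n/2}\int_{\mathbb{R}^n} f(t)\,e^{-\pi i\left((|t|^2+|\omega|^2)\cot\theta-2\,\omega\cdot t\,\csc\theta\right)}\,dt$$ be the fractional Fourier transform, extended to an isometry of $L^2(\mathbb{R}^n)$, and for $s\in\mathbb{R}^n$ let $T_s^\theta f(t)=e^{2\pi i\, s\cdot(t-s)\cot\theta}f(t-s)$ be the $\theta$-translation. For measurable $\Omega\subset\mathbb{R}^n$ put $V_\Omega^\theta=\{f\in L^2(\mathbb{R}^n):\mathscr{F}_\theta f(\omega)=0\text{ for a.e. }\omega\in\mathbb{R}^n\setminus\Omega\}$. Call $\Omega$ a fractional $\ell$-multi-tile if $\sum_{t\in \mathbb{Z}^n\sin\theta}\chi_\Omega(\omega+t)=\ell$ for a.e. $\omega\in\mathbb{R}^n$. Let $\mathcal{T}^{\ell,\theta}$ be the set of closed subspaces $V\subset L^2(\mathbb{R}^n)$ for which there are $\phi_1,\dots,\phi_\ell\in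 L^2(\mathbb{R}^n)$ such that $\{T_k^\theta\phi_j:k\in\mathbb{Z}^n,\ 1\le j\le\ell\}$ is a Riesz basis for $V$ (that is, its closed linear span is $V$ and, for constants $0<C_1\le C_2<\infty$, $C_1\sum|c_{k,j}|^2\le\|\sum c_{k,j}T_k^\theta\phi_j\|^2\le C_2\sum|c_{k,j}|^2$ for all finitely supported $(c_{k,j})$). For $N\in\mathbb{N}$ let $\mathcal{T}_N^{\ell,\theta}$ be the set of those $V\in\mathcal{T}^{\ell,\theta}$ that are of the form $V=V_\Omega^\theta$ with a measurable fractional $\ell$-multi-tile $\Omega\subset[-(N+\tfrac12),N+\tfrac12]^n$. **Theorem.** Let $m,\ell\in\mathbb{N}$ and $f_1,\dots,f_m\in L^2(\mathbb{R}^n)$. Then for every $N\in\mathbb{N}$ with $N\ge\ell$ there is a $V^*\in\mathcal{T}_N^{\ell,\theta}$ such that $$\sum_{j=1}^m\|f_j-P_{V^*}f_j\|^2\le\sum_{j=1}^m\|f_j-P_{V}f_j\|^2\qquad\text{for all }V\in\mathcal{T}_N^{\ell,\theta},$$ where $P_V$ denotes the orthogonal projection of $L^2(\mathbb{R}^n)$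 onto $V$. -/

import Mathlib

open MeasureTheory
open scoped ENNReal FourierTransform InnerProductSpace

noncomputable section

namespace FrFT

/-- The Euclidean space `ℝⁿ`. -/
abbrev E (n : ℕ) : Type := EuclideanSpace ℝ (Fin n)

/-- The Hilbert space `L²(ℝⁿ)` of complex valued functions, for Lebesgue measure. -/
abbrev L2 (n : ℕ) : Type := Lp ℂ 2 (volume : Measure (E n))

section WeightedComposition

variable {n : ℕ}

theorem map_affine (c : ℝ) (hc : c ≠ 0) (s : E n) :
    (volume : Measure (E n)).map (fun x => c • x + s)
      = ENNReal.ofReal ((|c| ^ n)⁻¹) • (volume : Measure (E n)) := by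
  have h1 : (fun x : E n => c • x + s) = (fun x => x + s) ∘ (fun x => c • x) := rfl
  rw [h1, ← Measure.map_map (measurable_add_const s) (measurable_const_smul c),
    Measure.map_addHaar_smul _ hc, Measure.map_smul, map_add_right_eq_self]
  simp

theorem quasi_affine (c : ℝ) (hc : c ≠ 0) (s : E n) :
    Measure.QuasiMeasurePreserving (fun x : E n => c • x + s) volume volume := by
  refine ⟨by fun_prop, ?_⟩
  rw [map_affine c hc s]
  exact Measure.smul_absolutelyContinuous

theorem eLpNorm_weighted (c : ℝ) (hc : c ≠ 0) (s : E n) (a : E n → ℂ)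
    (hnorm : ∀ x, ‖a x‖ ^ 2 = |c| ^ n) (f : L2 n) :
    eLpNorm (fun x => a x * f (c • x + s)) 2 (volume : Measure (E n)) = eLpNorm f 2 volume := by
  have hcn : 0 < |c| ^ n := by positivity
  have h1 : eLpNorm (fun x => a x * f (c • x + s)) 2 (volume : Measure (E n))
      = eLpNorm ((Real.sqrt (|c| ^ n)) • (f ∘ fun x => c • x + s)) 2 volume := by
    apply eLpNorm_congr_norm_ae
    filter_upwards with x
    have : ‖a x‖ = Real.sqrt (|c| ^ n) := by
      rw [← hnorm x, Real.sqrt_sq (norm_nonneg _)]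
    simp [this, abs_of_nonneg (Real.sqrt_nonneg _)]
  rw [h1, eLpNorm_const_smul, ← eLpNorm_map_measure, map_affine c hc s,
    eLpNorm_smul_measure_of_ne_zero (by simp [hcn]), smul_eq_mul, ← mul_assoc]
  · have h2 : ‖Real.sqrt (|c| ^ n)‖ₑ * ENNReal.ofReal ((|c| ^ n)⁻¹) ^ (1 / (2 : ℝ≥0∞)).toReal = 1 := by
      rw [Real.enorm_eq_ofReal (Real.sqrt_nonneg _), ENNReal.ofReal_rpow_of_pos (by positivity),
        ← ENNReal.ofReal_mul (Real.sqrt_nonneg _)]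
      have : (1 / (2 : ℝ≥0∞)).toReal = 1 / 2 := by simp
      rw [this, ← Real.sqrt_eq_rpow, ← Real.sqrt_mul (by positivity),
        mul_inv_cancel₀ hcn.ne', Real.sqrt_one, ENNReal.ofReal_one]
    rw [h2, one_mul]
  · rw [map_affine c hc s]
    exact (Lp.aestronglyMeasurable f).mono_ac Measure.smul_absolutelyContinuous
  · fun_prop

theorem memLp_weighted (c : ℝ) (hc : c ≠ 0) (s : E n) (a : E n → ℂ) (ha : Continuous a)
    (hnorm : ∀ x, ‖a x‖ ^ 2 = |c| ^ n) (f : L2 n) :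
    MemLp (fun x => a x * f (c • x + s)) 2 (volume : Measure (E n)) := by
  refine ⟨?_, ?_⟩
  · exact ha.aestronglyMeasurable.mul
      ((Lp.aestronglyMeasurable f).comp_quasiMeasurePreserving (quasi_affine c hc s))
  · rw [eLpNorm_weighted c hc s a hnorm f]
    exact Lp.eLpNorm_lt_top f

/-- The weighted composition operator `f ↦ (x ↦ a(x) f(c x + s))` with `|a(x)|² = |c|ⁿ`,
as a linear isometry of `L²(ℝⁿ)`. -/
def weightedComp (c : ℝ) (hc : c ≠ 0) (s : E n) (a : E n → ℂ) (ha : Continuous a)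
    (hnorm : ∀ x, ‖a x‖ ^ 2 = |c| ^ n) : L2 n →ₗᵢ[ℂ] L2 n where
  toFun f := (memLp_weighted c hc s a ha hnorm f).toLp _
  map_add' f g := by
    rw [← MemLp.toLp_add]
    apply MemLp.toLp_congr
    filter_upwards [(quasi_affine c hc s).ae (Lp.coeFn_add f g)] with x hx
    rw [hx, Pi.add_apply, Pi.add_apply, mul_add]
  map_smul' r f := by
    simp only [RingHom.id_apply]
    rw [← MemLp.toLp_const_smul]
    apply MemLp.toLp_congr
    filter_upwards [(quasi_affine c hc s).ae (Lp.coeFn_smul r f)] with x hx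
    simp [hx, mul_left_comm]
  norm_map' f := by
    simp only [LinearMap.coe_mk, AddHom.coe_mk]
    rw [Lp.norm_toLp, eLpNorm_weighted c hc s a hnorm f, Lp.norm_def]

theorem weightedComp_ae (c : ℝ) (hc : c ≠ 0) (s : E n) (a : E n → ℂ) (ha : Continuous a)
    (hnorm : ∀ x, ‖a x‖ ^ 2 = |c| ^ n) (f : L2 n) :
    weightedComp c hc s a ha hnorm f =ᵐ[volume] fun x => a x * f (c • x + s) :=
  MemLp.coeFn_toLp (memLp_weighted c hc s a ha hnorm f)

end WeightedComposition

/-- The unimodular number `exp(π i r)`. -/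
def phase (r : ℝ) : ℂ := Complex.exp (((Real.pi * r : ℝ) : ℂ) * Complex.I)

theorem norm_phase (r : ℝ) : ‖phase r‖ = 1 := Complex.norm_exp_ofReal_mul_I _

theorem continuous_phase : Continuous phase := by unfold phase; fun_prop

/-- Chirp modulation `(C_θ f)(t) = exp(π i |t|² cot θ) f(t)` on `L²(ℝⁿ)`. -/
def chirp {n : ℕ} (θ : ℝ) : L2 n →ₗᵢ[ℂ] L2 n :=
  weightedComp 1 one_ne_zero 0 (fun t => phase (‖t‖ ^ 2 * Real.cot θ))
    (continuous_phase.comp (by fun_prop)) (fun t => by simp [norm_phase])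

/-- The `θ`-translation `(T_s^θ f)(t) = exp(2 π i s·(t - s) cot θ) f(t - s)` on `L²(ℝⁿ)`. -/
def thetaTranslation {n : ℕ} (θ : ℝ) (s : E n) : L2 n →ₗᵢ[ℂ] L2 n :=
  weightedComp 1 one_ne_zero (-s) (fun t => phase (2 * ⟪s, t - s⟫_ℝ * Real.cot θ))
    (continuous_phase.comp (by fun_prop)) (fun t => by simp [norm_phase])

theorem thetaTranslation_ae {n : ℕ} (θ : ℝ) (s : E n) (f : L2 n) :
    thetaTranslation θ s f =ᵐ[volume]
      fun t => phase (2 * ⟪s, t - s⟫_ℝ * Real.cot θ) * f (t - s) := by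
  filter_upwards [weightedComp_ae 1 one_ne_zero (-s)
    (fun t => phase (2 * ⟪s, t - s⟫_ℝ * Real.cot θ))
    (continuous_phase.comp (by fun_prop)) (fun t => by simp [norm_phase]) f] with t ht
  rw [thetaTranslation, ht, one_smul, sub_eq_add_neg]

theorem frft_weight_norm {n : ℕ} (θ : ℝ) (ω : E n) :
    ‖((|Real.sin θ| ^ (-(n : ℝ) / 2) : ℝ) : ℂ) * phase (-(‖ω‖ ^ 2 * Real.cot θ))‖ ^ 2
      = |-(Real.sin θ)⁻¹| ^ n := by
  rw [norm_mul, norm_phase, mul_one, Complex.norm_real, Real.norm_eq_abs, sq_abs,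
    ← Real.rpow_natCast, ← Real.rpow_mul (abs_nonneg _), abs_neg, abs_inv, inv_pow,
    ← Real.rpow_natCast, ← Real.rpow_neg (abs_nonneg _)]
  congr 1
  push_cast
  ring

/-- The fractional Fourier transform on `L²(ℝⁿ)`, for `sin θ ≠ 0`. It is the isometric extension of
`(F_θ f)(ω) = |sin θ|^{-n/2} ∫ f(t) exp(-π i ((|t|² + |ω|²) cot θ - 2 ω·t csc θ)) dt`,
written through the `L²` Fourier transform:
`(F_θ f)(ω) = |sin θ|^{-n/2} exp(-π i |ω|² cot θ) · 𝓕(exp(-π i |t|² cot θ) f)(-ω csc θ)`. -/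
def frft {n : ℕ} (θ : ℝ) (hθ : Real.sin θ ≠ 0) : L2 n →ₗᵢ[ℂ] L2 n :=
  (weightedComp (-(Real.sin θ)⁻¹) (neg_ne_zero.mpr (inv_ne_zero hθ)) 0
      (fun ω => ((|Real.sin θ| ^ (-(n : ℝ) / 2) : ℝ) : ℂ) * phase (-(‖ω‖ ^ 2 * Real.cot θ)))
      (continuous_const.mul (continuous_phase.comp (by fun_prop))) (frft_weight_norm θ)).comp
    ((Lp.fourierTransformₗᵢ (E n) ℂ).toLinearIsometry.comp (chirp (-θ)))

/-- On `L¹ ∩ L²`, the `L²` Fourier transform is given by the Fourier integral. -/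
theorem fourier_ae_eq_of_integrable {n : ℕ} (f : L2 n) (hf : Integrable f volume) :
    Lp.fourierTransformₗᵢ (E n) ℂ f =ᵐ[volume] 𝓕 (f : E n → ℂ) := by
  apply ae_eq_of_integral_contDiff_smul_eq
  · exact (Lp.memLp _).locallyIntegrable one_le_two
  · exact (VectorFourier.fourierIntegral_continuous Real.continuous_fourierChar
      continuous_inner hf).locallyIntegrable
  intro g hg hgc
  have hg₁ : HasCompactSupport (Complex.ofRealCLM ∘ g) := hgc.comp_left rfl
  have hg₂ : ContDiff ℝ ((⊤ : ℕ∞) : WithTop ℕ∞) (Complex.ofRealCLM ∘ g) := by fun_prop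
  set G : SchwartzMap (E n) ℂ := hg₁.toSchwartzMap hg₂ with hG
  have hGg : ∀ x, G x = (g x : ℂ) := fun x => rfl
  have h1 := congrArg (fun T => T G) (Lp.fourier_toTemperedDistribution_eq f)
  simp only [TemperedDistribution.fourier_apply, Lp.toTemperedDistribution_apply] at h1
  have h2 := VectorFourier.integral_fourierIntegral_smul_eq_flip (μ := volume) (ν := volume)
    (L := innerₗ (E n)) Real.continuous_fourierChar continuous_inner hf (G.integrable (μ := volume))
  calc ∫ x, g x • (Lp.fourierTransformₗᵢ (E n) ℂ f) x
      = ∫ x, G x • (𝓕 f : L2 n) x := by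
        simp only [hGg]
        rfl
    _ = ∫ x, (𝓕 G) x • f x := h1.symm
    _ = ∫ x, f x • (𝓕 G) x := by simp only [smul_eq_mul, mul_comm]
    _ = ∫ x, (𝓕 (f : E n → ℂ)) x • G x := by
        rw [flip_innerₗ] at h2
        exact h2.symm
    _ = ∫ x, g x • 𝓕 (f : E n → ℂ) x := by
        simp only [hGg, smul_eq_mul, mul_comm, Complex.real_smul]

/-- On `L¹ ∩ L²`, the fractional Fourier transform is given by its defining integral. -/
theorem frft_ae_eq_integral {n : ℕ} (θ : ℝ) (hθ : Real.sin θ ≠ 0) (f : L2 n)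
    (hf : Integrable f volume) :
    frft θ hθ f =ᵐ[volume] fun ω =>
      ((|Real.sin θ| ^ (-(n : ℝ) / 2) : ℝ) : ℂ) *
        ∫ t, f t * phase (-((‖t‖ ^ 2 + ‖ω‖ ^ 2) * Real.cot θ
          - 2 * ⟪ω, t⟫_ℝ * (Real.sin θ)⁻¹)) := by
  have hc : chirp (-θ) f =ᵐ[volume] fun t => phase (-(‖t‖ ^ 2 * Real.cot θ)) * f t := by
    filter_upwards [weightedComp_ae 1 one_ne_zero 0
      (fun t : E n => phase (‖t‖ ^ 2 * Real.cot (-θ)))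
      (continuous_phase.comp (by fun_prop)) (fun t => by simp [norm_phase]) f] with t ht
    rw [chirp, ht, one_smul, add_zero]
    simp [Real.cot_eq_cos_div_sin, div_neg]
  have hci : Integrable (chirp (-θ) f) volume := by
    refine Integrable.congr ?_ hc.symm
    exact hf.bdd_mul (c := 1) (continuous_phase.comp (by fun_prop)).aestronglyMeasurable
      (Filter.Eventually.of_forall fun t => (norm_phase _).le)
  have h1 := (quasi_affine (n := n) (-(Real.sin θ)⁻¹) (neg_ne_zero.mpr (inv_ne_zero hθ)) 0).ae
    (fourier_ae_eq_of_integrable _ hci)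
  filter_upwards [weightedComp_ae (-(Real.sin θ)⁻¹) (neg_ne_zero.mpr (inv_ne_zero hθ)) 0
      (fun ω : E n => ((|Real.sin θ| ^ (-(n : ℝ) / 2) : ℝ) : ℂ) * phase (-(‖ω‖ ^ 2 * Real.cot θ)))
      (continuous_const.mul (continuous_phase.comp (by fun_prop))) (frft_weight_norm θ)
      (Lp.fourierTransformₗᵢ (E n) ℂ (chirp (-θ) f)), h1] with ω h2 h3
  have h4 : frft θ hθ f ω = _ := h2
  rw [h4, h3, mul_assoc, Real.fourier_eq', ← integral_const_mul]
  congr 1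
  apply integral_congr_ae
  filter_upwards [hc] with t ht
  rw [ht, smul_eq_mul]
  have h5 : ∀ a b c : ℂ, ∀ z : ℂ, a * (b * (c * z)) = z * (a * b * c) := by intros; ring
  rw [h5]
  congr 1
  simp only [phase, ← Complex.exp_add, add_zero, inner_smul_right]
  congr 1
  rw [real_inner_comm t ω]
  push_cast
  ring

theorem isClosed_vanishing {n : ℕ} (Ω : Set (E n)) :
    IsClosed {g : L2 n | ∀ᵐ ω, ω ∉ Ω → g ω = 0} := by
  rw [← isSeqClosed_iff_isClosed]
  intro u g hu hg
  obtain ⟨ns, -, hns⟩ := (tendstoInMeasure_of_tendsto_Lp hg).exists_seq_tendsto_ae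
  have hu' : ∀ᵐ ω, ∀ i, ω ∉ Ω → u i ω = 0 := ae_all_iff.mpr hu
  filter_upwards [hns, hu'] with ω h1 h2 h3
  have h4 : (fun i => u (ns i) ω) = fun _ => 0 := funext fun i => h2 (ns i) h3
  rw [h4] at h1
  exact (tendsto_nhds_unique h1 tendsto_const_nhds)

/-- The space `V_Ω^θ` of functions whose fractional Fourier transform vanishes a.e. outside `Ω`. -/
def bandlimited {n : ℕ} (θ : ℝ) (hθ : Real.sin θ ≠ 0) (Ω : Set (E n)) :
    ClosedSubmodule ℂ (L2 n) where
  carrier := {f | ∀ᵐ ω, ω ∉ Ω → frft θ hθ f ω = 0}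
  zero_mem' := by
    have h : frft θ hθ (0 : L2 n) =ᵐ[volume] 0 := by
      rw [map_zero]; exact Lp.coeFn_zero _ _ _
    filter_upwards [h] with ω hω _ using hω
  add_mem' {f g} hf hg := by
    change ∀ᵐ ω, ω ∉ Ω → frft θ hθ (f + g) ω = 0
    have h : frft θ hθ (f + g) =ᵐ[volume] frft θ hθ f + frft θ hθ g := by
      rw [map_add]; exact Lp.coeFn_add _ _
    filter_upwards [h, hf, hg] with ω h1 h2 h3 h4
    rw [h1, Pi.add_apply, h2 h4, h3 h4, add_zero]
  smul_mem' c f hf := by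
    change ∀ᵐ ω, ω ∉ Ω → frft θ hθ (c • f) ω = 0
    have h : frft θ hθ (c • f) =ᵐ[volume] c • (frft θ hθ f : E n → ℂ) := by
      rw [map_smul]; exact Lp.coeFn_smul _ _
    filter_upwards [h, hf] with ω h1 h2 h3
    rw [h1, Pi.smul_apply, h2 h3, smul_zero]
  isClosed' := by
    have h : {f : L2 n | ∀ᵐ ω, ω ∉ Ω → frft θ hθ f ω = 0} =
        frft θ hθ ⁻¹' {g : L2 n | ∀ᵐ ω, ω ∉ Ω → g ω = 0} := rfl
    exact h ▸ (isClosed_vanishing Ω).preimage (frft θ hθ).continuous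

/-- `Ω` tiles `ℝⁿ` at level `ℓ` when translated by `L`. -/
def TilesAtLevel {n : ℕ} (Ω L : Set (E n)) (ℓ : ℕ) : Prop :=
  ∀ᵐ ω : E n, ∑' t : L, Ω.indicator (fun _ => (1 : ℝ≥0∞)) (ω + t) = ℓ

/-- The lattice `ℤⁿ`. -/
def intPoint {n : ℕ} (k : Fin n → ℤ) : E n := WithLp.toLp 2 fun i => (k i : ℝ)

/-- `Ω` is a fractional `ℓ` multi-tile: it tiles at level `ℓ` when translated by `ℤⁿ sin θ`. -/
def IsFractionalMultiTile {n : ℕ} (θ : ℝ) (ℓ : ℕ) (Ω : Set (E n)) : Prop :=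
  TilesAtLevel Ω (Set.range fun k : Fin n → ℤ => Real.sin θ • intPoint k) ℓ

/-- The cube `C_N = [-(N + 1/2), N + 1/2]ⁿ`. -/
def cube (n N : ℕ) : Set (E n) :=
  {x | ∀ i, x i ∈ Set.Icc (-((N : ℝ) + 1 / 2)) ((N : ℝ) + 1 / 2)}

/-- `M_N^{ℓ,θ}`: the measurable fractional `ℓ` multi-tiles contained in `C_N`. -/
def multiTiles (n : ℕ) (θ : ℝ) (ℓ N : ℕ) : Set (Set (E n)) :=
  {Ω | Ω ⊆ cube n N ∧ MeasurableSet Ω ∧ IsFractionalMultiTile θ ℓ Ω}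

/-- The family `e` is a Riesz basis for the closed subspace `V`. -/
def IsRieszBasisFor {H ι : Type*} [NormedAddCommGroup H] [InnerProductSpace ℂ H]
    (e : ι → H) (V : ClosedSubmodule ℂ H) : Prop :=
  (Submodule.span ℂ (Set.range e)).topologicalClosure = V.toSubmodule ∧
  ∃ C₁ C₂ : ℝ, 0 < C₁ ∧ C₁ ≤ C₂ ∧ ∀ c : ι →₀ ℂ,
    C₁ * ∑ i ∈ c.support, ‖c i‖ ^ 2 ≤ ‖∑ i ∈ c.support, c i • e i‖ ^ 2 ∧
    ‖∑ i ∈ c.support, c i • e i‖ ^ 2 ≤ C₂ * ∑ i ∈ c.support, ‖c i‖ ^ 2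

/-- `T^{ℓ,θ}`: the closed subspaces `V` of `L²(ℝⁿ)` for which there are `φ₁, …, φ_ℓ` such that the
`θ`-translates `T_k^θ φ_j`, `k ∈ ℤⁿ`, `1 ≤ j ≤ ℓ`, span a dense subspace of `V` and form a Riesz
basis for `V`. -/
def shiftSpaces (n : ℕ) (θ : ℝ) (ℓ : ℕ) : Set (ClosedSubmodule ℂ (L2 n)) :=
  {V | ∃ φ : Fin ℓ → L2 n, IsRieszBasisFor
    (fun p : (Fin n → ℤ) × Fin ℓ => thetaTranslation θ (intPoint p.1) (φ p.2)) V}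

/-- `T_N^{ℓ,θ}`: the spaces in `T^{ℓ,θ}` of the form `V_Ω^θ` with `Ω ∈ M_N^{ℓ,θ}`. -/
def bandlimitedShiftSpaces (n : ℕ) (θ : ℝ) (hθ : Real.sin θ ≠ 0) (ℓ N : ℕ) :
    Set (ClosedSubmodule ℂ (L2 n)) :=
  {V | V ∈ shiftSpaces n θ ℓ ∧ ∃ Ω ∈ multiTiles n θ ℓ N, V = bandlimited θ hθ Ω}

/-- The least squares error `∑ⱼ ‖fⱼ - P_V fⱼ‖²`, with `P_V` the orthogonal projection onto `V`. -/
def approxError {n m : ℕ} (f : Fin m → L2 n) (V : ClosedSubmodule ℂ (L2 n)) : ℝ :=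
  ∑ j, ‖f j - V.toSubmodule.starProjection (f j)‖ ^ 2

end FrFT
end

/-!
The fractional Fourier transform `F_θ` is unitary, and on the transform side the orthogonal
projection onto `V_Ω^θ` is truncation to `Ω`. Hence the error of `V_Ω^θ` is the energy
`G = ∑ⱼ |F_θ fⱼ|²` left outside `Ω`, and a best space is one whose band `Ω` captures as much of `G`
as possible (`approxError_le_of_setLIntegral_energy_le`).

A multi-tile of level `ℓ` picks `ℓ` points from almost every orbit of `sin θ ℤⁿ`, so the best choice
can be made orbit by orbit. Each orbit meets the cube in finitely many points, and in more than
`N ≥ ℓ` of them because `|sin θ| ≤ 1`. Rank these points by their value of `G`, with ties broken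
lexicographically, and let `topLayers` be the set of points of rank below `ℓ`. It is measurable,
since ranks are countable sums of indicators, and it picks the `ℓ` largest values from each orbit.
Unfolding integrals over a fundamental domain shows that it captures the most energy
(`setLIntegral_le_setLIntegral_topLayers`).

It remains to see that this band gives a space with a Riesz basis of `θ`-translates
(`bandlimited_iUnion_mem_shiftSpaces`). The set `topLayers` is the disjoint union of the `ℓ` layers
of points of a given rank, and each layer meets every orbit exactly once. Take for generators the
functions whose transforms are the indicators of the layers. As `F_θ` turns `θ`-translations by `ℤⁿ`
into multiplications by plane waves (`frft_thetaTranslation`), the translates become plane waves cut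
off to the layers. They are orthogonal with equal norms and complete on each layer, by the theory of
Fourier series on the torus `(ℝ/ℤ)ⁿ`, into which a layer embeds measurably.
-/

noncomputable section

namespace FrFT

/-! ### Ranking a finite set -/

section Ranking

variable {α β : Type*} [LinearOrder β]

/-- For an injective key on a finite set `A`, every `j < |A|` is the number of elements of `A`
above a unique element of `A`. -/
theorem existsUnique_encard_above_eq {A : Set α} (hA : A.Finite) {key : α → β}
    (hkey : Function.Injective key) {j : ℕ} (hj : j < A.ncard) :
    ∃! a, a ∈ A ∧ {b ∈ A | key a < key b}.encard = j := by
  have hfin : ∀ a, {b ∈ A | key a < key b}.Finite := fun a => hA.subset fun b hb => hb.1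
  have hlt : ∀ a b, b ∈ A → key a < key b →
      {c ∈ A | key b < key c}.ncard < {c ∈ A | key a < key c}.ncard := fun a b hb hab =>
    Set.ncard_lt_ncard ⟨fun c hc => ⟨hc.1, hab.trans hc.2⟩,
      fun h => lt_irrefl _ (h ⟨hb, hab⟩).2⟩ (hfin a)
  have hinj : ∀ a b, a ∈ A → b ∈ A →
      {c ∈ A | key a < key c}.ncard = {c ∈ A | key b < key c}.ncard → a = b := by
    intro a b ha hb h
    rcases lt_trichotomy (key a) (key b) with h1 | h1 | h1
    · exact absurd h (hlt a b hb h1).ne'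
    · exact hkey h1
    · exact absurd h (hlt b a ha h1).ne
  have hcast : ∀ a, {b ∈ A | key a < key b}.encard = j ↔ {b ∈ A | key a < key b}.ncard = j := by
    intro a
    rw [← (hfin a).cast_ncard_eq, Nat.cast_inj]
  -- The number of elements above is injective from `A` to `{0, …, |A| - 1}`, hence onto.
  simp only [hcast]
  have hsurj := Finset.surj_on_of_inj_on_of_card_le (s := hA.toFinset)
    (t := Finset.range A.ncard) (fun a _ => {b ∈ A | key a < key b}.ncard)
    (fun a ha => Finset.mem_range.2 (Set.ncard_lt_ncard ⟨fun c hc => hc.1,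
      fun h => lt_irrefl _ (h (hA.mem_toFinset.1 ha)).2⟩ hA))
    (fun a b ha hb h => hinj a b (hA.mem_toFinset.1 ha) (hA.mem_toFinset.1 hb) h)
    (by rw [Finset.card_range, Set.ncard_eq_toFinset_card A hA]) j (Finset.mem_range.2 hj)
  obtain ⟨a, ha, hja⟩ := hsurj
  have ha' := hA.mem_toFinset.1 ha
  exact ⟨a, ⟨ha', hja.symm⟩, fun b hb => hinj b a hb.1 ha' (hb.2.trans hja)⟩

/-- A finite set whose elements dominate `g` on another set of the same size carries the larger
sum. -/
theorem tsum_indicator_le_of_dominates {g : α → ℝ≥0∞} {S T : Set α} {ℓ : ℕ} (hS : S.encard = ℓ)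
    (hT : T.encard = ℓ) (h : ∀ a ∈ T, ∀ b ∈ S, b ∉ T → g b ≤ g a) :
    ∑' a, S.indicator g a ≤ ∑' a, T.indicator g a := by
  classical
  obtain ⟨S, rfl⟩ := (Set.finite_of_encard_eq_coe hS).exists_finset_coe
  obtain ⟨T, rfl⟩ := (Set.finite_of_encard_eq_coe hT).exists_finset_coe
  rw [Set.encard_coe_eq_coe_finsetCard, Nat.cast_inj] at hS hT
  have hsum : ∀ U : Finset α, ∑' a, (U : Set α).indicator g a = ∑ a ∈ U, g a := fun U => by
    rw [← tsum_subtype, Finset.tsum_subtype' U g]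
  rw [hsum, hsum, ← Finset.sum_inter_add_sum_sdiff S T, ← Finset.sum_inter_add_sum_sdiff T S,
    Finset.inter_comm T S]
  gcongr 1
  have hcard : (S \ T).card = (T \ S).card := Finset.card_sdiff_comm (hS.trans hT.symm)
  rcases (S \ T).eq_empty_or_nonempty with h0 | h0
  · simp [h0]
  · obtain ⟨b, hb, hmax⟩ := Finset.exists_max_image (S \ T) g h0
    rw [Finset.mem_sdiff] at hb
    calc ∑ a ∈ S \ T, g a ≤ (S \ T).card • g b := Finset.sum_le_card_nsmul _ _ _ hmax
      _ = (T \ S).card • g b := by rw [hcard]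
      _ ≤ ∑ a ∈ T \ S, g a := Finset.card_nsmul_le_sum _ _ _ fun a ha =>
        h a (Finset.mem_sdiff.1 ha).1 b hb.1 hb.2

end Ranking

/-! ### The lattice and its orbits in the cube -/

/-- The lattice `s ℤⁿ`, as an additive subgroup of `ℝⁿ` acting by translations. -/
def lattice (n : ℕ) (s : ℝ) : AddSubgroup (E n) where
  carrier := Set.range fun k : Fin n → ℤ => s • intPoint k
  zero_mem' := ⟨0, by ext i; simp [intPoint]⟩
  add_mem' := by
    rintro _ _ ⟨k, rfl⟩ ⟨l, rfl⟩
    exact ⟨k + l, by ext i; simp [intPoint, mul_add]⟩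
  neg_mem' := by
    rintro _ ⟨k, rfl⟩
    exact ⟨-k, by ext i; simp [intPoint]⟩

instance (n : ℕ) (s : ℝ) : Countable (lattice n s) := (Set.countable_range _).to_subtype

section Orbits

variable {n : ℕ} {s : ℝ}

theorem vadd_eq_coe_add (t : lattice n s) (x : E n) : t +ᵥ x = (t : E n) + x := rfl

/-- The point `s k` of the lattice `s ℤⁿ`. -/
def latticePoint (s : ℝ) (k : Fin n → ℤ) : lattice n s := ⟨s • intPoint k, k, rfl⟩

theorem latticePoint_vadd_apply (k : Fin n → ℤ) (x : E n) (i : Fin n) :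
    (latticePoint s k +ᵥ x) i = s * k i + x i := rfl

theorem latticePoint_surjective : Function.Surjective (latticePoint (n := n) s) := by
  rintro ⟨_, k, rfl⟩
  exact ⟨k, rfl⟩

theorem latticePoint_injective (hs : s ≠ 0) : Function.Injective (latticePoint (n := n) s) := by
  intro k l h
  ext i
  have h1 := congrArg (fun t : lattice n s => (t : E n) i) h
  simpa [latticePoint, intPoint, hs] using h1

theorem finite_orbit_inter_cube (hs : s ≠ 0) (N : ℕ) (x : E n) :
    {t : lattice n s | t +ᵥ x ∈ cube n N}.Finite := by
  have hK : {k : Fin n → ℤ | latticePoint s k +ᵥ x ∈ cube n N}.Finite := by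
    have hbox : (Set.univ.pi fun i : Fin n =>
        {m : ℤ | |s * m + x i| ≤ (N : ℝ) + 1 / 2}).Finite := by
      refine Set.Finite.pi fun i => ?_
      refine (Set.finite_Icc (-⌈((N : ℝ) + 1 / 2 + |x i|) / |s|⌉)
        ⌈((N : ℝ) + 1 / 2 + |x i|) / |s|⌉).subset fun m hm => ?_
      have h1 : |(m : ℝ)| ≤ ((N : ℝ) + 1 / 2 + |x i|) / |s| := by
        rw [le_div_iff₀ (abs_pos.2 hs), ← abs_mul]
        have h2 : |(m : ℝ) * s| ≤ |m * s + x i| + |x i| := by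
          have := abs_sub (s * m + x i) (x i)
          rwa [add_sub_cancel_right, mul_comm s] at this
        have h3 : |m * s + x i| ≤ (N : ℝ) + 1 / 2 := by rw [mul_comm]; exact hm
        linarith
      have h4 := h1.trans (Int.le_ceil _)
      rw [abs_le] at h4
      exact ⟨by exact_mod_cast h4.1, by exact_mod_cast h4.2⟩
    refine hbox.subset fun k hk i _ => ?_
    exact abs_le.2 (hk i)
  refine (hK.image (latticePoint s)).subset fun t ht => ?_
  obtain ⟨k, rfl⟩ := latticePoint_surjective t
  exact ⟨k, ht, rfl⟩

/-- As `|s| ≤ 1`, each orbit of `s ℤⁿ` has more than `N` points in the cube of half-width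
`N + 1/2`: move to within `1/2` of the origin, then take up to `N` steps along one axis. -/
theorem lt_ncard_orbit_inter_cube (hn : 0 < n) (hs : s ≠ 0) (hs1 : |s| ≤ 1) (N : ℕ) (x : E n) :
    N < {t : lattice n s | t +ᵥ x ∈ cube n N}.ncard := by
  classical
  set p : ℕ → lattice n s := fun r =>
    latticePoint s ((fun i => -round (x i / s)) + Pi.single ⟨0, hn⟩ (r : ℤ)) with hp
  have hpinj : Function.Injective p := fun r r' h => by
    have h1 := congrFun (add_left_cancel (latticePoint_injective hs h)) ⟨0, hn⟩
    simpa using h1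
  have hsub : p '' (Finset.range (N + 1) : Set ℕ) ⊆ {t : lattice n s | t +ᵥ x ∈ cube n N} := by
    rintro _ ⟨r, hr, rfl⟩ i
    rw [Set.mem_Icc, ← abs_le]
    have hr : (r : ℝ) ≤ N := by
      have := Finset.mem_range.1 (Finset.mem_coe.1 hr)
      exact_mod_cast Nat.lt_succ_iff.1 this
    have h1 : |s * (x i / s - round (x i / s))| ≤ 1 / 2 := by
      rw [abs_mul]
      calc |s| * |x i / s - round (x i / s)| ≤ 1 * (1 / 2) := by
            gcongr
            exact abs_sub_round _
        _ = 1 / 2 := one_mul _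
    have h2 : |s * ((Pi.single (⟨0, hn⟩ : Fin n) (r : ℤ) : Fin n → ℤ) i : ℝ)| ≤ N := by
      rw [abs_mul]
      have h3 : |((Pi.single (⟨0, hn⟩ : Fin n) (r : ℤ) : Fin n → ℤ) i : ℝ)| ≤ N := by
        by_cases hi : i = ⟨0, hn⟩
        · subst hi; simpa using hr
        · simp [Pi.single_eq_of_ne hi]
      calc _ ≤ 1 * (N : ℝ) := by gcongr
        _ = N := one_mul _
    have h4 : (p r +ᵥ x) i = s * (x i / s - round (x i / s))
        + s * ((Pi.single (⟨0, hn⟩ : Fin n) (r : ℤ) : Fin n → ℤ) i : ℝ) := by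
      rw [hp, latticePoint_vadd_apply, mul_sub, mul_div_cancel₀ _ hs]
      push_cast [Pi.add_apply]
      ring
    rw [h4]
    exact (abs_add_le _ _).trans (by linarith)
  have h5 := Set.ncard_le_ncard hsub (finite_orbit_inter_cube hs N x)
  rw [Set.ncard_image_of_injective _ hpinj, Set.ncard_coe_finset, Finset.card_range] at h5
  exact h5

end Orbits

/-! ### Layers of the cube by rank -/

section Layers

variable {n : ℕ}

/-- The key by which the points of an orbit are ranked: the value of `G`, ties being broken by the
lexicographic order of `ℝⁿ`. -/
def key (G : E n → ℝ≥0∞) (x : E n) : ℝ≥0∞ ×ₗ Lex (Fin n → ℝ) := toLex (G x, toLex x.ofLp)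

theorem key_injective (G : E n → ℝ≥0∞) : Function.Injective (key G) := by
  intro x y h
  have h1 := congrArg Prod.snd (toLex.injective h)
  exact WithLp.ofLp_injective 2 (toLex.injective h1)

theorem le_of_key_le {G : E n → ℝ≥0∞} {x y : E n} (h : key G x ≤ key G y) : G x ≤ G y :=
  Prod.Lex.monotone_fst _ _ h

/-- The translations in `s ℤⁿ` that move `x` to a point of the cube with a larger key. -/
def above (s : ℝ) (N : ℕ) (G : E n → ℝ≥0∞) (x : E n) : Set (lattice n s) :=
  {t | t +ᵥ x ∈ cube n N ∧ key G x < key G (t +ᵥ x)}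

/-- The points of the cube with exactly `j` points of their orbit in the cube above them. -/
def layer (s : ℝ) (N : ℕ) (G : E n → ℝ≥0∞) (j : ℕ) : Set (E n) :=
  {x | x ∈ cube n N ∧ (above s N G x).encard = j}

/-- The points of the cube with fewer than `ℓ` points of their orbit in the cube above them. -/
def topLayers (s : ℝ) (N : ℕ) (G : E n → ℝ≥0∞) (ℓ : ℕ) : Set (E n) :=
  {x | x ∈ cube n N ∧ (above s N G x).encard < ℓ}

variable {s : ℝ} {N : ℕ} {G : E n → ℝ≥0∞}

theorem measurableSet_cube : MeasurableSet (cube n N) := by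
  have h : cube n N = ⋂ i, (fun x : E n => x i) ⁻¹' Set.Icc (-((N : ℝ) + 1 / 2)) (N + 1 / 2) := by
    ext x; simp [cube]
  rw [h]
  exact MeasurableSet.iInter fun i => measurableSet_Icc.preimage (by fun_prop)

theorem isBounded_cube : Bornology.IsBounded (cube n N) := by
  have h : cube n N ⊆ (WithLp.toLp 2) '' (Set.Icc (fun _ : Fin n => -((N : ℝ) + 1 / 2))
      (fun _ => (N : ℝ) + 1 / 2)) := fun x hx =>
    ⟨x.ofLp, ⟨fun i => (hx i).1, fun i => (hx i).2⟩, rfl⟩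
  exact ((isCompact_Icc.image (PiLp.continuous_toLp 2 _)).isBounded).subset h

theorem measurable_encard_above (hG : Measurable G) :
    Measurable fun x => ((above s N G x).encard : ℝ≥0∞) := by
  have h : ∀ x, ((above s N G x).encard : ℝ≥0∞)
      = ∑' t : lattice n s, {y | t ∈ above s N G y}.indicator 1 x := by
    intro x
    rw [← ENNReal.tsum_set_one, tsum_subtype (above s N G x) (fun _ => (1 : ℝ≥0∞))]
    rfl
  simp only [h]
  refine Measurable.tsum fun t => measurable_one.indicator ?_
  have h1 : {y | t ∈ above s N G y} = (fun y => t +ᵥ y) ⁻¹' cube n N ∩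
      ({y | G y < G (t +ᵥ y)} ∪ ({y | G y = G (t +ᵥ y)} ∩ {_y | 0 < toLex (t : E n).ofLp})) := by
    ext y
    -- Whether a translation raises the tie-breaking order does not depend on the point.
    have h2 : toLex y.ofLp < toLex (t +ᵥ y).ofLp ↔ 0 < toLex (t : E n).ofLp := by
      have : toLex (t +ᵥ y).ofLp = toLex (t : E n).ofLp + toLex y.ofLp := rfl
      rw [this, lt_add_iff_pos_left]
    simp only [above, key, Prod.Lex.lt_iff, ofLex_toLex, h2, Set.mem_ofPred_eq, Set.mem_inter_iff,
      Set.mem_preimage, Set.mem_union]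
  rw [h1]
  have h3 : Measurable fun y : E n => t +ᵥ y := measurable_const_vadd t
  exact (measurableSet_cube.preimage h3).inter ((measurableSet_lt hG (hG.comp h3)).union
    ((measurableSet_eq_fun hG (hG.comp h3)).inter (MeasurableSet.const _)))

theorem measurableSet_layer (hG : Measurable G) (j : ℕ) : MeasurableSet (layer s N G j) := by
  have h : layer s N G j
      = cube n N ∩ (fun x => ((above s N G x).encard : ℝ≥0∞)) ⁻¹' {(j : ℝ≥0∞)} := by
    ext x
    simp only [layer, Set.mem_ofPred_eq, Set.mem_inter_iff, Set.mem_preimage, Set.mem_singleton_iff]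
    rw [← ENat.toENNReal_coe j, ENat.toENNReal_inj]
  rw [h]
  exact measurableSet_cube.inter ((measurable_encard_above hG) (measurableSet_singleton _))

theorem layer_subset_cube (j : ℕ) : layer s N G j ⊆ cube n N := fun _ hx => hx.1

theorem topLayers_eq_iUnion (ℓ : ℕ) : topLayers s N G ℓ = ⋃ j : Fin ℓ, layer s N G j := by
  ext x
  simp only [topLayers, layer, Set.mem_ofPred_eq, Set.mem_iUnion]
  constructor
  · rintro ⟨hx, h⟩
    obtain ⟨j, hj⟩ := ENat.ne_top_iff_exists.1 (h.trans_le le_top).ne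
    rw [← hj, Nat.cast_lt] at h
    exact ⟨⟨j, h⟩, hx, hj.symm⟩
  · rintro ⟨j, hx, h⟩
    exact ⟨hx, by rw [h]; exact_mod_cast j.2⟩

theorem measurableSet_topLayers (hG : Measurable G) (ℓ : ℕ) :
    MeasurableSet (topLayers s N G ℓ) := by
  rw [topLayers_eq_iUnion]
  exact MeasurableSet.iUnion fun j => measurableSet_layer hG j

theorem disjoint_layer {i j : ℕ} (h : i ≠ j) : Disjoint (layer s N G i) (layer s N G j) := by
  refine Set.disjoint_left.2 fun x hi hj => h ?_
  exact_mod_cast hi.2.symm.trans hj.2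

/-- The rank of the point `t +ᵥ x`, counted over the whole orbit as seen from `x`. -/
theorem encard_above_vadd (t : lattice n s) (x : E n) :
    (above s N G (t +ᵥ x)).encard
      = {u : lattice n s | u +ᵥ x ∈ cube n N ∧ key G (t +ᵥ x) < key G (u +ᵥ x)}.encard := by
  rw [← (Equiv.addRight t).injective.encard_image]
  congr 1
  ext u
  constructor
  · rintro ⟨v, hv, rfl⟩
    simpa [above, add_vadd] using hv
  · intro hu
    refine ⟨u - t, ?_, by simp⟩
    have h : (u - t) +ᵥ (t +ᵥ x) = u +ᵥ x := by rw [← add_vadd, sub_add_cancel]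
    simpa only [above, Set.mem_ofPred_eq, h] using hu

theorem existsUnique_vadd_mem_layer (hn : 0 < n) (hs : s ≠ 0) (hs1 : |s| ≤ 1) {j : ℕ}
    (hj : j ≤ N) (x : E n) : ∃! t : lattice n s, t +ᵥ x ∈ layer s N G j := by
  have h := existsUnique_encard_above_eq (finite_orbit_inter_cube hs N x)
    (key := fun t : lattice n s => key G (t +ᵥ x)) (fun t u h => by
      have := key_injective G h
      rw [vadd_eq_coe_add, vadd_eq_coe_add] at this
      exact Subtype.ext (add_right_cancel this))
    (hj.trans_lt (lt_ncard_orbit_inter_cube hn hs hs1 N x))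
  simpa only [layer, Set.mem_ofPred_eq, encard_above_vadd] using h

theorem isAddFundamentalDomain_layer (hn : 0 < n) (hs : s ≠ 0) (hs1 : |s| ≤ 1)
    (hG : Measurable G) {j : ℕ} (hj : j ≤ N) :
    IsAddFundamentalDomain (lattice n s) (layer s N G j) volume :=
  .mk' (measurableSet_layer hG j).nullMeasurableSet (existsUnique_vadd_mem_layer hn hs hs1 hj)

theorem encard_vadd_mem_topLayers (hn : 0 < n) (hs : s ≠ 0) (hs1 : |s| ≤ 1) {ℓ : ℕ} (hℓ : ℓ ≤ N)
    (x : E n) : {t : lattice n s | t +ᵥ x ∈ topLayers s N G ℓ}.encard = ℓ := by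
  have hj : ∀ j : Fin ℓ, ∃! t : lattice n s, t +ᵥ x ∈ layer s N G j := fun j =>
    existsUnique_vadd_mem_layer hn hs hs1 (j.2.le.trans hℓ) x
  choose t ht htu using hj
  have hinj : Function.Injective t := by
    intro i j hij
    have h1 : t i +ᵥ x ∈ layer s N G j := by rw [hij]; exact ht j
    by_contra hne
    exact Set.disjoint_left.1 (disjoint_layer (Fin.val_ne_of_ne hne)) (ht i) h1
  have h : {t : lattice n s | t +ᵥ x ∈ topLayers s N G ℓ} = Set.range t := by
    ext u
    simp only [topLayers_eq_iUnion, Set.mem_ofPred_eq, Set.mem_iUnion, Set.mem_range]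
    exact ⟨fun ⟨j, hj⟩ => ⟨j, (htu j u hj).symm⟩, fun ⟨j, hj⟩ => ⟨j, hj ▸ ht j⟩⟩
  rw [h, ← Set.image_univ, hinj.encard_image, Set.encard_univ]
  simp

theorem tsum_indicator_add_eq_encard (Ω : Set (E n)) (x : E n) :
    ∑' t : (Set.range fun k : Fin n → ℤ => s • intPoint k),
      Ω.indicator (fun _ => (1 : ℝ≥0∞)) (x + t) = {t : lattice n s | t +ᵥ x ∈ Ω}.encard := by
  rw [← ENNReal.tsum_set_one, tsum_subtype _ (fun _ => (1 : ℝ≥0∞))]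
  refine tsum_congr fun t => ?_
  rw [add_comm]
  rfl

theorem topLayers_mem_multiTiles {θ : ℝ} (hn : 0 < n) (hθ : Real.sin θ ≠ 0) (hG : Measurable G)
    {ℓ : ℕ} (hℓ : ℓ ≤ N) : topLayers (Real.sin θ) N G ℓ ∈ multiTiles n θ ℓ N := by
  refine ⟨fun x hx => hx.1, measurableSet_topLayers hG ℓ, Filter.Eventually.of_forall fun x => ?_⟩
  rw [tsum_indicator_add_eq_encard,
    encard_vadd_mem_topLayers hn hθ (Real.abs_sin_le_one θ) hℓ]
  simp

/-- Among the multi-tiles in the cube, the union of the top `ℓ` layers has the largest integral of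
`G`: unfold both integrals over a fundamental domain and compare them orbit by orbit. -/
theorem setLIntegral_le_setLIntegral_topLayers {θ : ℝ} (hn : 0 < n) (hθ : Real.sin θ ≠ 0)
    (hG : Measurable G) {ℓ : ℕ} (hℓ : ℓ ≤ N) {Ω : Set (E n)} (hΩ : Ω ∈ multiTiles n θ ℓ N) :
    ∫⁻ x in Ω, G x ≤ ∫⁻ x in topLayers (Real.sin θ) N G ℓ, G x := by
  obtain ⟨hΩC, hΩm, hΩt⟩ := hΩ
  have hs1 := Real.abs_sin_le_one θ
  -- The layer of top-ranked points serves as the fundamental domain, also when `ℓ = 0`.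
  have hD := isAddFundamentalDomain_layer hn hθ hs1 hG (Nat.zero_le N)
  have hunfold : ∀ U : Set (E n), MeasurableSet U → ∫⁻ x in U, G x
      = ∫⁻ x in layer (Real.sin θ) N G 0, ∑' t : lattice n (Real.sin θ),
        {u : lattice n (Real.sin θ) | u +ᵥ x ∈ U}.indicator (fun u => G (u +ᵥ x)) t := by
    intro U hU
    rw [← lintegral_indicator hU, hD.lintegral_eq_tsum'', ← lintegral_tsum]
    · rfl
    · exact fun t => ((hG.indicator hU).comp (measurable_const_vadd t)).aemeasurable
  rw [hunfold Ω hΩm, hunfold _ (measurableSet_topLayers hG ℓ)]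
  refine lintegral_mono_ae (ae_restrict_of_ae ?_)
  filter_upwards [hΩt] with x hx
  rw [tsum_indicator_add_eq_encard] at hx
  refine tsum_indicator_le_of_dominates (ℓ := ℓ) (by
    rw [← ENat.toENNReal_inj, hx]; simp) (encard_vadd_mem_topLayers hn hθ hs1 hℓ x) ?_
  intro t ht u hu hut
  refine le_of_key_le (le_of_not_ge fun hlt => hut ⟨hΩC hu, lt_of_le_of_lt ?_ ht.2⟩)
  rw [encard_above_vadd, encard_above_vadd]
  exact Set.encard_le_encard fun v hv => ⟨hv.1, lt_of_le_of_lt hlt hv.2⟩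

end Layers

/-! ### Fourier series on a fundamental domain -/

section Torus

open UnitAddTorus

variable {n : ℕ} {s : ℝ}

/-- The normalized Haar measure of the torus `(ℝ/ℤ)ⁿ`. -/
def torusHaar (n : ℕ) : Measure (UnitAddTorus (Fin n)) :=
  Measure.pi fun _ => AddCircle.haarAddCircle

instance : IsProbabilityMeasure (torusHaar n) := by unfold torusHaar; infer_instance

/-- The quotient map `x ↦ x / s` from `ℝⁿ` modulo `s ℤⁿ` to the torus `(ℝ/ℤ)ⁿ`. -/
def torusMap (s : ℝ) (x : E n) : UnitAddTorus (Fin n) := fun i => ((s⁻¹ * x i : ℝ) : UnitAddCircle)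

theorem continuous_torusMap : Continuous (torusMap (n := n) s) :=
  continuous_pi fun i => (AddCircle.continuous_mk' 1).comp (by fun_prop)

theorem measurable_torusMap : Measurable (torusMap (n := n) s) := continuous_torusMap.measurable

theorem torusMap_vadd (hs : s ≠ 0) (t : lattice n s) (x : E n) :
    torusMap s (t +ᵥ x) = torusMap s x := by
  obtain ⟨k, rfl⟩ := latticePoint_surjective t
  ext i
  simp only [torusMap, latticePoint_vadd_apply]
  rw [mul_add, inv_mul_cancel_left₀ hs, AddCircle.coe_add]
  have h : ((k i : ℝ) : UnitAddCircle) = 0 := (AddCircle.coe_eq_zero_iff 1).2 ⟨k i, by simp⟩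
  rw [h, zero_add]

theorem exists_vadd_eq_of_torusMap_eq (hs : s ≠ 0) {x y : E n} (h : torusMap s x = torusMap s y) :
    ∃ t : lattice n s, t +ᵥ x = y := by
  have h1 : ∀ i, ∃ m : ℤ, m • (1 : ℝ) = s⁻¹ * y i - s⁻¹ * x i := fun i => by
    rw [← AddCircle.coe_eq_zero_iff, AddCircle.coe_sub, sub_eq_zero]
    exact (congrFun h i).symm
  choose k hk using h1
  refine ⟨latticePoint s k, ?_⟩
  ext i
  have h2 := hk i
  rw [zsmul_one] at h2
  rw [latticePoint_vadd_apply, h2, ← mul_sub, mul_inv_cancel_left₀ hs, sub_add_cancel]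

/-- The exponential monomials of the torus are the plane waves of the dual lattice. -/
theorem mFourier_torusMap (k : Fin n → ℤ) (x : E n) :
    mFourier k (torusMap s x) = phase (2 * ⟪intPoint k, x⟫_ℝ * s⁻¹) := by
  simp only [mFourier, ContinuousMap.coe_mk, torusMap, fourier_coe_apply, phase]
  rw [← Complex.exp_sum]
  congr 1
  simp only [PiLp.inner_apply, intPoint, RCLike.inner_apply, conj_trivial]
  push_cast
  rw [Finset.mul_sum, Finset.sum_mul, Finset.mul_sum, Finset.sum_mul]
  refine Finset.sum_congr rfl fun i _ => ?_
  ring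

/-- The half-open fundamental parallelepiped of `s ℤⁿ`. -/
def box (n : ℕ) (s : ℝ) : Set (E n) := {x | ∀ i, s⁻¹ * x i ∈ Set.Ioc (0 : ℝ) (0 + 1)}

theorem measurableSet_box : MeasurableSet (box n s) := by
  have h : box n s = ⋂ i, (fun x : E n => s⁻¹ * x i) ⁻¹' Set.Ioc (0 : ℝ) (0 + 1) := by
    ext x; simp [box]
  rw [h]
  exact MeasurableSet.iInter fun i => measurableSet_Ioc.preimage (by fun_prop)

theorem isAddFundamentalDomain_box (hs : s ≠ 0) :
    IsAddFundamentalDomain (lattice n s) (box n s) volume := by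
  refine .mk' measurableSet_box.nullMeasurableSet fun x => ?_
  choose k hk hku using fun i : Fin n =>
    existsUnique_add_zsmul_mem_Ioc one_pos (s⁻¹ * x i) (0 : ℝ)
  have hmem : ∀ l : Fin n → ℤ, latticePoint s l +ᵥ x ∈ box n s ↔
      ∀ i, s⁻¹ * x i + l i • (1 : ℝ) ∈ Set.Ioc (0 : ℝ) (0 + 1) := fun l => by
    refine forall_congr' fun i => ?_
    rw [latticePoint_vadd_apply, mul_add, inv_mul_cancel_left₀ hs, zsmul_one,
      add_comm (l i : ℝ)]
  refine ⟨latticePoint s k, (hmem k).2 hk, fun t ht => ?_⟩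
  obtain ⟨l, rfl⟩ := latticePoint_surjective t
  rw [funext fun i => hku i _ ((hmem l).1 ht i)]

theorem map_torusMap_restrict_box (hs : s ≠ 0) :
    (volume.restrict (box n s)).map (torusMap s) = ENNReal.ofReal (|s| ^ n) • torusHaar n := by
  set u : E n → (Fin n → ℝ) := fun x i => s⁻¹ * x i with hu
  have hum : Measurable u := by fun_prop
  have hmapu : (volume : Measure (E n)).map u = ENNReal.ofReal (|s| ^ n) • volume := by
    have h1 : u = (fun x : E n => x.ofLp) ∘ fun x => s⁻¹ • x := rfl
    have h2 := PiLp.volume_preserving_ofLp (Fin n)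
    rw [h1, ← Measure.map_map h2.measurable (measurable_const_smul _),
      Measure.map_addHaar_smul _ (inv_ne_zero hs), Measure.map_smul, h2.map_eq]
    simp [abs_pow]
  have h3 : box n s = u ⁻¹' Set.univ.pi fun _ => Set.Ioc (0 : ℝ) (0 + 1) := by
    ext x; simp [box, hu]
  have h4 : torusMap (n := n) s = (fun y i => (y i : UnitAddCircle)) ∘ u := rfl
  have h5 : MeasurePreserving (fun (y : Fin n → ℝ) i => (y i : UnitAddCircle))
      (Measure.pi fun _ => volume.restrict (Set.Ioc (0 : ℝ) (0 + 1))) (torusHaar n) := by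
    refine measurePreserving_pi _ _ fun i => ?_
    have := AddCircle.measurePreserving_mk 1 0
    rwa [AddCircle.volume_eq_smul_haarAddCircle, ENNReal.ofReal_one, one_smul] at this
  rw [h4, ← Measure.map_map h5.measurable hum, h3,
    ← Measure.restrict_map hum (MeasurableSet.univ_pi fun _ => measurableSet_Ioc), hmapu,
    Measure.restrict_smul, Measure.map_smul, volume_pi, Measure.restrict_pi_pi, h5.map_eq]

/-- On every fundamental domain of `s ℤⁿ`, the quotient map carries Lebesgue measure to `|s|ⁿ`
times Haar measure. -/
theorem map_torusMap_restrict (hs : s ≠ 0) {D : Set (E n)}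
    (hD : IsAddFundamentalDomain (lattice n s) D volume) :
    (volume.restrict D).map (torusMap s) = ENNReal.ofReal (|s| ^ n) • torusHaar n := by
  rw [← map_torusMap_restrict_box hs]
  ext B hB
  have hB' := measurable_torusMap (s := s) hB
  rw [Measure.map_apply measurable_torusMap hB, Measure.map_apply measurable_torusMap hB,
    Measure.restrict_apply hB', Measure.restrict_apply hB']
  exact hD.measure_set_eq (isAddFundamentalDomain_box hs) hB' fun t => by
    ext x; simp only [Set.mem_preimage, torusMap_vadd hs]

theorem integral_mFourier (k : Fin n → ℤ) :
    ∫ z, mFourier k z ∂torusHaar n = if k = 0 then 1 else 0 := by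
  have h := orthonormal_iff_ite.1 (orthonormal_mFourier (d := Fin n)) 0 k
  simp only [ContinuousMap.inner_toLp, mFourier_zero, ContinuousMap.one_apply, map_one,
    mul_one, eq_comm (a := (0 : Fin n → ℤ))] at h
  exact h

theorem setIntegral_mFourier_torusMap (hs : s ≠ 0) {D : Set (E n)}
    (hD : IsAddFundamentalDomain (lattice n s) D volume) (k : Fin n → ℤ) :
    ∫ x in D, mFourier k (torusMap s x) = if k = 0 then ((|s| ^ n : ℝ) : ℂ) else 0 := by
  rw [← integral_map (μ := volume.restrict D) measurable_torusMap.aemeasurable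
    (mFourier k).continuous.aestronglyMeasurable, map_torusMap_restrict hs hD,
    integral_smul_measure, integral_mFourier, ENNReal.toReal_ofReal (by positivity)]
  split_ifs <;> simp

/-- A square-integrable function on the torus whose Fourier coefficients vanish is zero. -/
theorem ae_eq_zero_of_integral_mFourier_eq_zero {g : UnitAddTorus (Fin n) → ℂ}
    (hg : MemLp g 2 (torusHaar n)) (h : ∀ k, ∫ z, mFourier (-k) z * g z ∂torusHaar n = 0) :
    g =ᵐ[torusHaar n] 0 := by
  have hF := hg.coeFn_toLp
  have h1 : ∀ k, mFourierBasis.repr (hg.toLp g) k = 0 := fun k =>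
    ((mFourierBasis_repr (hg.toLp g) k).trans (integral_congr_ae
      (hF.mono fun z hz => congrArg (mFourier (-k) z * ·) hz))).trans (h k)
  have h2 : hg.toLp g = 0 :=
    (LinearIsometryEquiv.map_eq_zero_iff mFourierBasis.repr).1 (lp.ext (funext h1))
  exact hF.symm.trans (h2 ▸ Lp.coeFn_zero ℂ 2 (torusHaar n))

/-- The plane waves are complete in `L²` of an exact fundamental domain `D`: as `D` embeds
measurably in the torus, a function on `D` is the pullback of a function on the torus. -/
theorem ae_eq_zero_of_setIntegral_mFourier_torusMap_eq_zero (hs : s ≠ 0) {D : Set (E n)}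
    (hDm : MeasurableSet D) (hD : ∀ x, ∃! t : lattice n s, t +ᵥ x ∈ D) {g : E n → ℂ}
    (hgm : Measurable g) (hg : MemLp g 2 (volume.restrict D))
    (h : ∀ k, ∫ x in D, mFourier (-k) (torusMap s x) * g x = 0) :
    g =ᵐ[volume.restrict D] 0 := by
  have hinj : Function.Injective fun x : D => torusMap s (x : E n) := by
    intro x y hxy
    obtain ⟨t, ht⟩ := exists_vadd_eq_of_torusMap_eq hs hxy
    have h1 : t = 0 := (hD x).unique (by rw [ht]; exact y.2) (by rw [zero_vadd]; exact x.2)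
    rw [h1, zero_vadd] at ht
    exact Subtype.ext ht
  have := hDm.standardBorel
  have hemb := (measurable_torusMap.comp measurable_subtype_coe).measurableEmbedding hinj
  obtain ⟨g', hg'm, hg'⟩ :=
    hemb.exists_measurable_extend (hgm.comp measurable_subtype_coe) fun _ => ⟨0⟩
  have hgg' : ∀ᵐ x ∂volume.restrict D, g' (torusMap s x) = g x := by
    filter_upwards [ae_restrict_mem hDm] with x hx using congrFun hg' ⟨x, hx⟩
  have hmap := map_torusMap_restrict hs (IsAddFundamentalDomain.mk' (μ := volume)
    hDm.nullMeasurableSet hD)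
  have hc : ENNReal.ofReal (|s| ^ n) ≠ 0 := by
    exact (ENNReal.ofReal_pos.2 (by positivity)).ne'
  have hmem : MemLp g' 2 (torusHaar n) := by
    refine (MemLp.of_measure_le_smul (c := (ENNReal.ofReal (|s| ^ n))⁻¹)
      (μ := (volume.restrict D).map (torusMap s)) (by simpa using hc) ?_ ?_)
    · rw [hmap, smul_smul, ENNReal.inv_mul_cancel hc ENNReal.ofReal_ne_top, one_smul]
    · rw [memLp_map_measure_iff hg'm.aestronglyMeasurable measurable_torusMap.aemeasurable]
      exact hg.ae_eq (hgg'.mono fun x hx => hx.symm)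
  have hzero : g' =ᵐ[torusHaar n] 0 := by
    refine ae_eq_zero_of_integral_mFourier_eq_zero hmem fun k => ?_
    have hm : Measurable fun z => mFourier (-k) z * g' z :=
      (mFourier (-k)).continuous.measurable.mul hg'm
    have h1 : ∫ z, mFourier (-k) z * g' z ∂((volume.restrict D).map (torusMap s)) = 0 := by
      rw [integral_map measurable_torusMap.aemeasurable hm.aestronglyMeasurable, ← h k]
      exact integral_congr_ae (hgg'.mono fun x hx => by simp only [hx])
    rw [hmap, integral_smul_measure, ENNReal.toReal_ofReal (by positivity)] at h1
    exact (smul_eq_zero.1 h1).resolve_left (by positivity)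
  have hzero' : g' =ᵐ[(volume.restrict D).map (torusMap s)] 0 := by
    rw [hmap]
    exact Measure.smul_absolutelyContinuous hzero
  filter_upwards [hgg', ae_of_ae_map measurable_torusMap.aemeasurable hzero'] with x h1 h2
  rw [← h1, h2]
  rfl

end Torus

/-! ### The fractional Fourier transform as a unitary operator -/

section Unitary

variable {n : ℕ}

theorem phase_add (a b : ℝ) : phase (a + b) = phase a * phase b := by
  rw [phase, phase, phase, ← Complex.exp_add]
  congr 1
  push_cast
  ring

theorem weightedComp_surjective (c : ℝ) (hc : c ≠ 0) (s : E n) (a : E n → ℂ) (ha : Continuous a)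
    (hnorm : ∀ x, ‖a x‖ ^ 2 = |c| ^ n) : Function.Surjective (weightedComp c hc s a ha hnorm) := by
  intro g
  have ha0 : ∀ x, a x ≠ 0 := fun x h => by
    have h1 := hnorm x
    rw [h, norm_zero, zero_pow two_ne_zero] at h1
    exact (pow_pos (abs_pos.2 hc) n).ne h1
  set b : E n → ℂ := fun y => (a (c⁻¹ • y + -(c⁻¹ • s)))⁻¹ with hb
  have hbc : Continuous b := (ha.comp (by fun_prop)).inv₀ fun x => ha0 _
  have hbn : ∀ y, ‖b y‖ ^ 2 = |c⁻¹| ^ n := fun y => by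
    rw [hb, norm_inv, inv_pow, hnorm, abs_inv, inv_pow]
  refine ⟨weightedComp c⁻¹ (inv_ne_zero hc) (-(c⁻¹ • s)) b hbc hbn g, ?_⟩
  apply Lp.ext
  filter_upwards [weightedComp_ae c hc s a ha hnorm
      (weightedComp c⁻¹ (inv_ne_zero hc) (-(c⁻¹ • s)) b hbc hbn g),
    (quasi_affine c hc s).ae (weightedComp_ae c⁻¹ (inv_ne_zero hc) (-(c⁻¹ • s)) b hbc hbn g)]
    with x h1 h2
  have h3 : c⁻¹ • (c • x + s) + -(c⁻¹ • s) = x := by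
    rw [smul_add, inv_smul_smul₀ hc, add_neg_cancel_right]
  rw [h1, h2]
  simp only [hb, h3]
  rw [mul_inv_cancel_left₀ (ha0 x)]

theorem frft_surjective (θ : ℝ) (hθ : Real.sin θ ≠ 0) : Function.Surjective (frft (n := n) θ hθ) :=
  (weightedComp_surjective (-(Real.sin θ)⁻¹) (neg_ne_zero.mpr (inv_ne_zero hθ)) 0 _
      (continuous_const.mul (continuous_phase.comp (by fun_prop))) (frft_weight_norm θ)).comp
    ((Lp.fourierTransformₗᵢ (E n) ℂ).surjective.comp
      (weightedComp_surjective 1 one_ne_zero 0 _ (continuous_phase.comp (by fun_prop))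
        (fun t => by simp [norm_phase])))

/-- The unimodular multiplier to which the fractional Fourier transform takes the `θ`-translation
by `s`. -/
def waveMul (θ : ℝ) (s : E n) : L2 n →ₗᵢ[ℂ] L2 n :=
  weightedComp 1 one_ne_zero 0
    (fun ω => phase (-(‖s‖ ^ 2 * Real.cot θ)) * phase (2 * ⟪s, ω⟫_ℝ * (Real.sin θ)⁻¹))
    (continuous_const.mul (continuous_phase.comp (by fun_prop))) (fun t => by simp [norm_phase])

theorem waveMul_ae (θ : ℝ) (s : E n) (f : L2 n) :
    waveMul θ s f =ᵐ[volume] fun ω =>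
      phase (-(‖s‖ ^ 2 * Real.cot θ)) * phase (2 * ⟪s, ω⟫_ℝ * (Real.sin θ)⁻¹) * f ω := by
  filter_upwards [weightedComp_ae 1 one_ne_zero 0
    (fun ω : E n => phase (-(‖s‖ ^ 2 * Real.cot θ)) * phase (2 * ⟪s, ω⟫_ℝ * (Real.sin θ)⁻¹))
    (continuous_const.mul (continuous_phase.comp (by fun_prop)))
    (fun t => by simp [norm_phase]) f] with t ht
  rw [waveMul, ht, one_smul, add_zero]

/-- For integrable functions the intertwining relation is the substitution `t ↦ t - s` in the
defining integral. -/
theorem frft_thetaTranslation_of_integrable (θ : ℝ) (hθ : Real.sin θ ≠ 0) (s : E n) (f : L2 n)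
    (hf : Integrable f volume) :
    frft θ hθ (thetaTranslation θ s f) = waveMul θ s (frft θ hθ f) := by
  have hT := thetaTranslation_ae θ s f
  have hTi : Integrable (thetaTranslation θ s f) volume := by
    refine Integrable.congr ?_ hT.symm
    exact (hf.comp_sub_right s).bdd_mul (c := 1)
      (continuous_phase.comp (by fun_prop)).aestronglyMeasurable
      (Filter.Eventually.of_forall fun t => (norm_phase _).le)
  apply Lp.ext
  filter_upwards [frft_ae_eq_integral θ hθ _ hTi, waveMul_ae θ s (frft θ hθ f),
    frft_ae_eq_integral θ hθ f hf] with ω h1 h2 h3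
  rw [h1, h2, h3, mul_left_comm]
  congr 1
  rw [← integral_const_mul]
  refine Eq.trans ?_ (integral_sub_right_eq_self _ s)
  apply integral_congr_ae
  filter_upwards [hT] with t ht
  rw [ht]
  have h4 : ∀ a b c d e : ℂ, a * b = c * d * e → a * f (t - s) * b = c * d * (f (t - s) * e) := by
    intro a b c d e h
    linear_combination f (t - s) * h
  apply h4
  rw [← phase_add, ← phase_add, ← phase_add]
  congr 1
  have h5 : ‖t‖ ^ 2 = ‖t - s‖ ^ 2 + 2 * ⟪s, t - s⟫_ℝ + ‖s‖ ^ 2 := by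
    have h6 := norm_add_sq_real (t - s) s
    rw [sub_add_cancel, real_inner_comm] at h6
    exact h6
  rw [h5, inner_sub_right ω, real_inner_comm s ω]
  ring

/-- The fractional Fourier transform takes `θ`-translations to multiplications by plane waves;
this extends from the dense subspace of Schwartz functions. -/
theorem frft_thetaTranslation (θ : ℝ) (hθ : Real.sin θ ≠ 0) (s : E n) (f : L2 n) :
    frft θ hθ (thetaTranslation θ s f) = waveMul θ s (frft θ hθ f) := by
  refine (SchwartzMap.denseRange_toLpCLM (E := E n) (F := ℂ) (p := 2) (μ := volume)
    ENNReal.ofNat_ne_top).induction_on (p := fun f =>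
      frft θ hθ (thetaTranslation θ s f) = waveMul θ s (frft θ hθ f)) f ?_ fun g => ?_
  · exact isClosed_eq
      ((frft θ hθ).continuous.comp (thetaTranslation θ s).continuous)
      ((waveMul θ s).continuous.comp (frft θ hθ).continuous)
  · exact frft_thetaTranslation_of_integrable θ hθ s _
      ((g.integrable (μ := volume)).congr (g.coeFn_toLp 2 volume).symm)

end Unitary

/-! ### The approximation error of a band-limited space -/

section Error

variable {n : ℕ}

/-- The truncation of an `L²` function to a measurable set. -/
def cutoff {Ω : Set (E n)} (hΩ : MeasurableSet Ω) (f : L2 n) : L2 n :=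
  ((Lp.memLp f).indicator hΩ).toLp _

theorem cutoff_ae {Ω : Set (E n)} (hΩ : MeasurableSet Ω) (f : L2 n) :
    cutoff hΩ f =ᵐ[volume] Ω.indicator f := MemLp.coeFn_toLp _

theorem mem_bandlimited {θ : ℝ} {hθ : Real.sin θ ≠ 0} {Ω : Set (E n)} {f : L2 n} :
    f ∈ (bandlimited θ hθ Ω).toSubmodule ↔ ∀ᵐ ω, ω ∉ Ω → frft θ hθ f ω = 0 := Iff.rfl

/-- The projection onto `V_Ω^θ` is truncation to `Ω` on the transform side, so the squared error is
the energy of the transform outside `Ω`. -/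
theorem ofReal_norm_sub_starProjection_sq (θ : ℝ) (hθ : Real.sin θ ≠ 0) {Ω : Set (E n)}
    (hΩ : MeasurableSet Ω) (f : L2 n) :
    ENNReal.ofReal (‖f - (bandlimited θ hθ Ω).toSubmodule.starProjection f‖ ^ 2)
      = ∫⁻ ω in Ωᶜ, ‖frft θ hθ f ω‖ₑ ^ 2 := by
  obtain ⟨p, hp⟩ := frft_surjective θ hθ (cutoff hΩ (frft θ hθ f))
  have hpae : frft θ hθ p =ᵐ[volume] Ω.indicator (frft θ hθ f) := by
    rw [hp]; exact cutoff_ae hΩ _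
  have hsub : frft θ hθ (f - p) =ᵐ[volume] Ωᶜ.indicator (frft θ hθ f) := by
    rw [map_sub]
    filter_upwards [Lp.coeFn_sub (frft θ hθ f) (frft θ hθ p), hpae] with ω h1 h2
    rw [h1, Pi.sub_apply, h2, Set.indicator_compl, Pi.sub_apply]
  have hproj : (bandlimited θ hθ Ω).toSubmodule.starProjection f = p := by
    refine Submodule.eq_starProjection_of_mem_of_inner_eq_zero ?_ fun w hw => ?_
    · rw [mem_bandlimited]
      filter_upwards [hpae] with ω h1 h2
      rw [h1, Set.indicator_of_notMem h2]
    · rw [← (frft θ hθ).inner_map_map, L2.inner_def]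
      rw [mem_bandlimited] at hw
      refine integral_eq_zero_of_ae ?_
      filter_upwards [hsub, hw] with ω h1 h2
      by_cases hω : ω ∈ Ω
      · rw [h1, Set.indicator_of_notMem (by simpa using hω), inner_zero_left]; rfl
      · rw [h2 hω, inner_zero_right]; rfl
  rw [hproj, ← (frft θ hθ).norm_map, Lp.norm_def, ← ENNReal.toReal_pow, ENNReal.ofReal_toReal
    (ENNReal.pow_ne_top (Lp.eLpNorm_ne_top _)), eLpNorm_congr_ae hsub,
    eLpNorm_indicator_eq_eLpNorm_restrict hΩ.compl,
    eLpNorm_eq_lintegral_rpow_enorm_toReal two_ne_zero ENNReal.ofNat_ne_top]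
  rw [← ENNReal.rpow_natCast, ← ENNReal.rpow_mul]
  simp

/-- The total energy density `∑ⱼ |F_θ fⱼ|²` on the transform side. -/
def energy {m : ℕ} (θ : ℝ) (hθ : Real.sin θ ≠ 0) (f : Fin m → L2 n) (ω : E n) : ℝ≥0∞ :=
  ∑ j, ‖frft θ hθ (f j) ω‖ₑ ^ 2

variable {m : ℕ}

theorem measurable_energy (θ : ℝ) (hθ : Real.sin θ ≠ 0) (f : Fin m → L2 n) :
    Measurable (energy θ hθ f) := by
  unfold energy
  exact Finset.measurable_sum _ fun j _ =>
    ((Lp.stronglyMeasurable _).measurable.enorm).pow_const 2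

theorem ofReal_approxError (θ : ℝ) (hθ : Real.sin θ ≠ 0) (f : Fin m → L2 n) {Ω : Set (E n)}
    (hΩ : MeasurableSet Ω) :
    ENNReal.ofReal (approxError f (bandlimited θ hθ Ω)) = ∫⁻ ω in Ωᶜ, energy θ hθ f ω := by
  rw [approxError, ENNReal.ofReal_sum_of_nonneg fun j _ => sq_nonneg _]
  simp only [ofReal_norm_sub_starProjection_sq θ hθ hΩ, energy]
  rw [lintegral_finsetSum _ fun j _ =>
    ((Lp.stronglyMeasurable _).measurable.enorm).pow_const 2]

/-- Capturing more energy in the band means a smaller approximation error. -/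
theorem approxError_le_of_setLIntegral_energy_le (θ : ℝ) (hθ : Real.sin θ ≠ 0) (f : Fin m → L2 n)
    {Ω Ω' : Set (E n)} (hΩ : MeasurableSet Ω) (hΩ' : MeasurableSet Ω')
    (h : ∫⁻ ω in Ω, energy θ hθ f ω ≤ ∫⁻ ω in Ω', energy θ hθ f ω) :
    approxError f (bandlimited θ hθ Ω') ≤ approxError f (bandlimited θ hθ Ω) := by
  have h0 : 0 ≤ approxError f (bandlimited θ hθ Ω) := Finset.sum_nonneg fun j _ => sq_nonneg _
  rw [← ENNReal.ofReal_le_ofReal_iff h0, ofReal_approxError θ hθ f hΩ,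
    ofReal_approxError θ hθ f hΩ']
  have hfin : ∫⁻ ω in Ω', energy θ hθ f ω ≠ ∞ := by
    -- The energy inside `Ω'` is the error of the band `Ω'ᶜ`.
    have h1 := ofReal_approxError θ hθ f hΩ'.compl
    rw [compl_compl] at h1
    rw [← h1]
    exact ENNReal.ofReal_ne_top
  have h2 : (∫⁻ ω in Ω', energy θ hθ f ω) + ∫⁻ ω in Ω'ᶜ, energy θ hθ f ω
      = (∫⁻ ω in Ω, energy θ hθ f ω) + ∫⁻ ω in Ωᶜ, energy θ hθ f ω := by
    rw [lintegral_add_compl _ hΩ, lintegral_add_compl _ hΩ']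
  refine (ENNReal.add_le_add_iff_left hfin).1 ?_
  rw [h2]
  gcongr

end Error

/-! ### Riesz bases of translates for unions of tiles -/

section Riesz

/-- An orthogonal family of vectors of equal norm that is total in `V` is a Riesz basis for `V`. -/
theorem isRieszBasisFor_of_inner_eq_ite {H ι : Type*} [NormedAddCommGroup H]
    [InnerProductSpace ℂ H] [CompleteSpace H] [DecidableEq ι] {e : ι → H} {V : ClosedSubmodule ℂ H}
    {c : ℝ} (hc : 0 < c) (he : ∀ i j, ⟪e i, e j⟫_ℂ = if i = j then (c : ℂ) else 0)
    (hmem : ∀ i, e i ∈ V.toSubmodule)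
    (htot : ∀ v ∈ V.toSubmodule, (∀ i, ⟪e i, v⟫_ℂ = 0) → v = 0) : IsRieszBasisFor e V := by
  refine ⟨le_antisymm ?_ fun v hv => ?_, c, c, hc, le_rfl, fun a => ?_⟩
  · exact Submodule.topologicalClosure_minimal _
      (Submodule.span_le.2 (Set.range_subset_iff.2 hmem)) V.isClosed
  · set W := (Submodule.span ℂ (Set.range e)).topologicalClosure with hW
    have hWV : W ≤ V.toSubmodule := Submodule.topologicalClosure_minimal _
      (Submodule.span_le.2 (Set.range_subset_iff.2 hmem)) V.isClosed
    have : CompleteSpace W := (Submodule.isClosed_topologicalClosure _).completeSpace_coe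
    have hPW : W.starProjection v ∈ W := Submodule.starProjection_apply_mem _ _
    have h0 : v - W.starProjection v = 0 := by
      refine htot _ (V.toSubmodule.sub_mem hv (hWV hPW)) fun i => ?_
      exact Submodule.inner_right_of_mem_orthogonal
        (Submodule.le_topologicalClosure (Submodule.span ℂ (Set.range e))
          (Submodule.subset_span (Set.mem_range_self i)))
        (Submodule.sub_starProjection_mem_orthogonal v)
    rw [sub_eq_zero.1 h0]
    exact hPW
  · have h : ‖∑ i ∈ a.support, a i • e i‖ ^ 2 = c * ∑ i ∈ a.support, ‖a i‖ ^ 2 := by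
      have h1 : ((‖∑ i ∈ a.support, a i • e i‖ ^ 2 : ℝ) : ℂ)
          = ((c * ∑ i ∈ a.support, ‖a i‖ ^ 2 : ℝ) : ℂ) := by
        have h2 := inner_self_eq_norm_sq_to_K (𝕜 := ℂ) (∑ i ∈ a.support, a i • e i)
        push_cast
        refine Eq.trans h2.symm ?_
        simp only [sum_inner, inner_sum, inner_smul_left, inner_smul_right, he]
        rw [Finset.mul_sum]
        refine Finset.sum_congr rfl fun i hi => ?_
        rw [Finset.sum_eq_single_of_mem i hi fun j _ hj => by simp [hj]]
        rw [if_pos rfl, ← mul_assoc, Complex.mul_conj', mul_comm]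
      exact_mod_cast h1
    exact ⟨h.ge, h.le⟩

open UnitAddTorus in
/-- If `Ω` is the disjoint union of `ℓ` tiles `D j` of `sin θ ℤⁿ`, then `V_Ω^θ` has a Riesz basis of
`θ`-translates: the generators have the indicators of the tiles as transforms, and the transforms of
their translates are the plane waves cut off to the tiles. -/
theorem bandlimited_iUnion_mem_shiftSpaces {n ℓ : ℕ} {θ : ℝ} (hθ : Real.sin θ ≠ 0)
    {D : Fin ℓ → Set (E n)} (hDm : ∀ j, MeasurableSet (D j)) (hDfin : ∀ j, volume (D j) ≠ ∞)
    (hDd : Pairwise fun i j => Disjoint (D i) (D j))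
    (hD : ∀ j x, ∃! t : lattice n (Real.sin θ), t +ᵥ x ∈ D j) :
    bandlimited θ hθ (⋃ j, D j) ∈ shiftSpaces n θ ℓ := by
  have hDf : ∀ j, IsAddFundamentalDomain (lattice n (Real.sin θ)) (D j) volume := fun j =>
    .mk' (hDm j).nullMeasurableSet (hD j)
  choose φ hφ using fun j => frft_surjective θ hθ (indicatorConstLp 2 (hDm j) (hDfin j) (1 : ℂ))
  have hae : ∀ p : (Fin n → ℤ) × Fin ℓ,
      frft θ hθ (thetaTranslation θ (intPoint p.1) (φ p.2)) =ᵐ[volume] fun ω =>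
        phase (-(‖intPoint p.1‖ ^ 2 * Real.cot θ)) *
          (D p.2).indicator (fun ω => mFourier p.1 (torusMap (Real.sin θ) ω)) ω := by
    intro p
    rw [frft_thetaTranslation, hφ]
    filter_upwards [waveMul_ae θ (intPoint p.1) (indicatorConstLp 2 (hDm p.2) (hDfin p.2) (1 : ℂ)),
      indicatorConstLp_coeFn (p := 2) (hs := hDm p.2) (hμs := hDfin p.2) (c := (1 : ℂ))] with ω h1 h2
    rw [h1, h2, mul_assoc]
    congr 1
    by_cases hω : ω ∈ D p.2
    · rw [Set.indicator_of_mem hω, Set.indicator_of_mem hω, mul_one, mFourier_torusMap]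
    · rw [Set.indicator_of_notMem hω, Set.indicator_of_notMem hω, mul_zero]
  have hphase : ∀ r, phase r ≠ 0 := fun r h => by
    have := norm_phase r
    rw [h, norm_zero] at this
    exact zero_ne_one this
  refine ⟨φ, isRieszBasisFor_of_inner_eq_ite (c := |Real.sin θ| ^ n) (by positivity) ?_ ?_ ?_⟩
  · rintro ⟨k, i⟩ ⟨l, j⟩
    rw [← (frft θ hθ).inner_map_map, L2.inner_def]
    have h1 : (fun ω => ⟪frft θ hθ (thetaTranslation θ (intPoint k) (φ i)) ω,
        frft θ hθ (thetaTranslation θ (intPoint l) (φ j)) ω⟫_ℂ) =ᵐ[volume] fun ω =>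
        (phase (-(‖intPoint l‖ ^ 2 * Real.cot θ)) *
          (starRingEnd ℂ) (phase (-(‖intPoint k‖ ^ 2 * Real.cot θ)))) *
          (D i ∩ D j).indicator (fun ω => mFourier (l - k) (torusMap (Real.sin θ) ω)) ω := by
      filter_upwards [hae (k, i), hae (l, j)] with ω h1 h2
      rw [h1, h2, RCLike.inner_apply, map_mul, mul_mul_mul_comm]
      congr 1
      by_cases hi : ω ∈ D i <;> by_cases hj : ω ∈ D j <;>
        simp [hi, hj, sub_eq_add_neg, mFourier_add, mFourier_neg]
    rw [integral_congr_ae h1, integral_const_mul,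
      integral_indicator ((hDm i).inter (hDm j))]
    by_cases hij : i = j
    · subst hij
      rw [Set.inter_self, setIntegral_mFourier_torusMap hθ (hDf i)]
      by_cases hkl : k = l
      · subst hkl
        rw [Complex.mul_conj', norm_phase]
        simp
      · rw [if_neg (sub_ne_zero.2 (Ne.symm hkl)), mul_zero,
          if_neg fun h => hkl (congrArg Prod.fst h)]
    · rw [(hDd hij).inter_eq, if_neg fun h => hij (congrArg Prod.snd h)]
      simp
  · intro p
    rw [mem_bandlimited]
    filter_upwards [hae p] with ω h1 h2
    rw [h1, Set.indicator_of_notMem fun h => h2 (Set.mem_iUnion_of_mem p.2 h), mul_zero]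
  · intro v hv horth
    have hzero : ∀ j, ∀ᵐ ω, ω ∈ D j → frft θ hθ v ω = 0 := by
      intro j
      rw [← ae_restrict_iff' (hDm j)]
      refine ae_eq_zero_of_setIntegral_mFourier_torusMap_eq_zero hθ (hDm j) (hD j)
        (Lp.stronglyMeasurable _).measurable ((Lp.memLp _).restrict _) fun k => ?_
      have h1 := horth (k, j)
      rw [← (frft θ hθ).inner_map_map, L2.inner_def] at h1
      have h2 : (fun ω => ⟪frft θ hθ (thetaTranslation θ (intPoint k) (φ j)) ω,
          frft θ hθ v ω⟫_ℂ) =ᵐ[volume] fun ω =>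
          (starRingEnd ℂ) (phase (-(‖intPoint k‖ ^ 2 * Real.cot θ))) * (D j).indicator
            (fun ω => mFourier (-k) (torusMap (Real.sin θ) ω) * frft θ hθ v ω) ω := by
        filter_upwards [hae (k, j)] with ω h2
        rw [h2, RCLike.inner_apply, map_mul, mul_left_comm]
        congr 1
        by_cases hj : ω ∈ D j <;> simp [hj, mFourier_neg, mul_comm]
      rw [integral_congr_ae h2, integral_const_mul, integral_indicator (hDm j)] at h1
      exact (mul_eq_zero.1 h1).resolve_left ((map_ne_zero _).2 (hphase _))
    have h0 : frft θ hθ v = 0 := by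
      apply Lp.ext
      rw [mem_bandlimited] at hv
      filter_upwards [hv, ae_all_iff.2 hzero, Lp.coeFn_zero ℂ 2 (volume : Measure (E n))]
        with ω h1 h2 h3
      rw [h3, Pi.zero_apply]
      by_cases hω : ω ∈ ⋃ j, D j
      · obtain ⟨j, hj⟩ := Set.mem_iUnion.1 hω
        exact h2 j hj
      · exact h1 hω
    exact (frft θ hθ).injective (h0.trans (map_zero _).symm)

theorem bandlimited_topLayers_mem {n ℓ N : ℕ} {θ : ℝ} (hn : 0 < n) (hθ : Real.sin θ ≠ 0)
    {G : E n → ℝ≥0∞} (hG : Measurable G) (hℓ : ℓ ≤ N) :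
    bandlimited θ hθ (topLayers (Real.sin θ) N G ℓ) ∈ bandlimitedShiftSpaces n θ hθ ℓ N := by
  refine ⟨?_, _, topLayers_mem_multiTiles hn hθ hG hℓ, rfl⟩
  rw [topLayers_eq_iUnion]
  exact bandlimited_iUnion_mem_shiftSpaces hθ (fun j => measurableSet_layer hG j)
    (fun j => (isBounded_cube.subset (layer_subset_cube _)).measure_lt_top.ne)
    (fun i j hij => disjoint_layer (Fin.val_ne_of_ne hij))
    fun j => existsUnique_vadd_mem_layer hn hθ (Real.abs_sin_le_one θ) (j.2.le.trans hℓ)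

end Riesz

end FrFT

end

theorem theorem4p9 (n : ℕ) (hn : 0 < n) (θ : ℝ) (hθ : Real.sin θ ≠ 0) (m ℓ : ℕ)
    (f : Fin m → FrFT.L2 n) (N : ℕ) (hN : ℓ ≤ N) :
    ∃ V ∈ FrFT.bandlimitedShiftSpaces n θ hθ ℓ N,
      IsMinOn (FrFT.approxError f) (FrFT.bandlimitedShiftSpaces n θ hθ ℓ N) V := by
  have hG := FrFT.measurable_energy θ hθ f
  refine ⟨_, FrFT.bandlimited_topLayers_mem hn hθ hG hN, ?_⟩
  rintro _ ⟨-, Ω, hΩ, rfl⟩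
  exact FrFT.approxError_le_of_setLIntegral_energy_le θ hθ f hΩ.2.1
    (FrFT.measurableSet_topLayers hG ℓ) (FrFT.setLIntegral_le_setLIntegral_topLayers hn hθ hG hN hΩ)
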